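/- **Theorem 1.** Let $n$ be a natural number, let $\nu>0$ be real, let $B$ be a real $n\times n$ matrix, and let $\Sigma_1,\Sigma_2$ be real symmetric positive definite $n\times n$ matrices. Write $|\cdot|$ for the determinant, $\mathrm{etr}(\cdot)=\exp(\mathrm{tr}(\cdot))$, and $\Gamma_n(z)=\pi^{n(n-1)/4}\prod_{i=1}^n\Gamma\bigl(z-\tfrac12(i-1)\bigr)$ for the multivariate gamma function. Let $W$ and $Y$ be random real $n\times n$ matrices on a common probability space such that (i) $W\sim\mathcal{IMG}_n\bigl(\tfrac{\nu+n-1}{2},2,\Sigma_1\bigr)$, where the inverted matrix variate gamma distribution $\mathcal{IMG}_n(\delta,\beta,\Psi)$ is the distribution on symmetric positive definite matrices $w$ with density $$\frac{|\Psi|^{\delta}}{\beta^{n\delta}\,\Gamma_n(\delta)}\,|w|^{-\delta-\frac{n+1}{2}}\,\mathrm{etr}\Bigl(-\tfrac1\beta\,\Psi\,w^{-1}\Bigr)$$ with respect to Lebesgue measure $\prod_{i\le j}dw_{ij}$ on symmetric matrices; (ii) conditionally on $W$, $Y\mid W\sim N_{n,n}(B,W,\Sigma_2)$, i.e. for almost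 every value $w$ of $W$ (with respect to the law of $W$) the conditional distribution of $Y$ given $W=w$ is the matrix variate normal distribution with density $$y\mapsto\frac{|w|^{-n/2}|\Sigma_2|^{-n/2}}{(2\pi)^{n^2/2}}\,\mathrm{etr}\Bigl(-\tfrac12\,\Sigma_2^{-1}(y-B)'\,w^{-1}(y-B)\Bigr)$$ with respect to Lebesgue measure on $\mathbb{R}^{n\times n}$. Then $Y$ is marginally matrix variate $t$, $Y\sim t_{n,n}(\nu,B,\Sigma_1,\Sigma_2)$; that is, $Y$ has density $$y\mapsto\frac{\Gamma_n\bigl(\frac{\nu+2n-1}{2}\bigr)}{\pi^{n^2/2}\,\Gamma_n\bigl(\frac{\nu+n-1}{2}\bigr)}\,|\Sigma_1|^{-n/2}|\Sigma_2|^{-n/2}\,\bigl|I_n+\Sigma_1^{-1}(y-B)\Sigma_2^{-1}(y-B)'\bigr|^{-\frac{\nu+2n-1}{2}}$$ with respect to Lebesgue measure on $\mathbb{R}^{n\times n}$. -/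

import Mathlib

open MeasureTheory ProbabilityTheory
open scoped Matrix

namespace MatrixT

/-- The product (equivalently Borel) σ-algebra on real matrices. -/
instance instMeasurableSpaceMatrix {m n : ℕ} : MeasurableSpace (Matrix (Fin m) (Fin n) ℝ) :=
  inferInstanceAs (MeasurableSpace (Fin m → Fin n → ℝ))

/-- Lebesgue measure `∏ i j, dx i j` on real matrices. -/
noncomputable instance instMeasureSpaceMatrix {m n : ℕ} :
    MeasureSpace (Matrix (Fin m) (Fin n) ℝ) :=
  inferInstanceAs (MeasureSpace (Fin m → Fin n → ℝ))

instance instBorelSpaceMatrix {m n : ℕ} : BorelSpace (Matrix (Fin m) (Fin n) ℝ) :=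
  inferInstanceAs (BorelSpace (Fin m → Fin n → ℝ))

instance instStandardBorelSpaceMatrix {m n : ℕ} :
    StandardBorelSpace (Matrix (Fin m) (Fin n) ℝ) :=
  inferInstanceAs (StandardBorelSpace (Fin m → Fin n → ℝ))

/-- The multivariate gamma function
`Γ_p(z) = π^(p(p-1)/4) ∏_{i=1}^p Γ(z - (i-1)/2)`; here `i` runs over `0, …, p-1`. -/
noncomputable def multiGamma (p : ℕ) (z : ℝ) : ℝ :=
  Real.pi ^ ((p : ℝ) * ((p : ℝ) - 1) / 4) *
    ∏ i ∈ Finset.range p, Real.Gamma (z - (i : ℝ) / 2)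

/-- The symmetric matrix whose entries on and above the diagonal are the given numbers. -/
def symMatrixOf {n : ℕ} (x : {p : Fin n × Fin n // p.1 ≤ p.2} → ℝ) :
    Matrix (Fin n) (Fin n) ℝ :=
  Matrix.of fun i j => x ⟨(min i j, max i j), min_le_max⟩

/-- Lebesgue measure `∏_{i ≤ j} dx i j` on symmetric matrices, as a measure on all matrices that
is carried by the symmetric ones. -/
noncomputable def symVolume (n : ℕ) : Measure (Matrix (Fin n) (Fin n) ℝ) :=
  (volume : Measure ({p : Fin n × Fin n // p.1 ≤ p.2} → ℝ)).map symMatrixOf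

/-- Density of the inverted matrix variate gamma distribution `IMG_n(δ, β, Ψ)` at a positive
definite `W`:
`|Ψ|^δ / (β^(nδ) Γ_n(δ)) · |W|^(-δ-(n+1)/2) · etr(-(1/β) Ψ W⁻¹)`. -/
noncomputable def invMatrixGammaPDF {n : ℕ} (δ β : ℝ) (Ψ W : Matrix (Fin n) (Fin n) ℝ) : ℝ :=
  Ψ.det ^ δ / (β ^ ((n : ℝ) * δ) * multiGamma n δ) *
    W.det ^ (-δ - ((n : ℝ) + 1) / 2) * Real.exp (-(1 / β) * (Ψ * W⁻¹).trace)

/-- The inverted matrix variate gamma distribution `IMG_n(δ, β, Ψ)`, a measure on positive definite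
matrices. -/
noncomputable def invMatrixGamma {n : ℕ} (δ β : ℝ) (Ψ : Matrix (Fin n) (Fin n) ℝ) :
    Measure (Matrix (Fin n) (Fin n) ℝ) :=
  ((symVolume n).restrict {W | W.PosDef}).withDensity
    fun W => ENNReal.ofReal (invMatrixGammaPDF δ β Ψ W)

/-- Density of the matrix variate normal distribution `N_{n,n}(M, Ω₁, Ω₂)`:
`|Ω₁|^(-n/2) |Ω₂|^(-n/2) / (2π)^(n²/2) · etr(-(1/2) Ω₂⁻¹ (X - M)' Ω₁⁻¹ (X - M))`. -/
noncomputable def matrixNormalPDF {n : ℕ} (M Ω₁ Ω₂ X : Matrix (Fin n) (Fin n) ℝ) : ℝ :=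
  Ω₁.det ^ (-(n : ℝ) / 2) * Ω₂.det ^ (-(n : ℝ) / 2) / (2 * Real.pi) ^ ((n : ℝ) ^ 2 / 2) *
    Real.exp (-(1 / 2) * (Ω₂⁻¹ * (X - M)ᵀ * Ω₁⁻¹ * (X - M)).trace)

/-- The matrix variate normal distribution `N_{n,n}(M, Ω₁, Ω₂)` (for positive definite
`Ω₁, Ω₂`). -/
noncomputable def matrixNormal {n : ℕ} (M Ω₁ Ω₂ : Matrix (Fin n) (Fin n) ℝ) :
    Measure (Matrix (Fin n) (Fin n) ℝ) :=
  volume.withDensity fun X => ENNReal.ofReal (matrixNormalPDF M Ω₁ Ω₂ X)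

/-- Density of the matrix variate t distribution `t_{n,n}(ν, M, Ω₁, Ω₂)`:
`Γ_n((ν+2n-1)/2) / (π^(n²/2) Γ_n((ν+n-1)/2)) · |Ω₁|^(-n/2) |Ω₂|^(-n/2)
  · |I + Ω₁⁻¹ (X - M) Ω₂⁻¹ (X - M)'|^(-(ν+2n-1)/2)`. -/
noncomputable def matrixTPDF {n : ℕ} (ν : ℝ) (M Ω₁ Ω₂ X : Matrix (Fin n) (Fin n) ℝ) : ℝ :=
  multiGamma n ((ν + 2 * (n : ℝ) - 1) / 2) /
      (Real.pi ^ ((n : ℝ) ^ 2 / 2) * multiGamma n ((ν + (n : ℝ) - 1) / 2)) *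
    Ω₁.det ^ (-(n : ℝ) / 2) * Ω₂.det ^ (-(n : ℝ) / 2) *
    (1 + Ω₁⁻¹ * (X - M) * Ω₂⁻¹ * (X - M)ᵀ).det ^ (-(ν + 2 * (n : ℝ) - 1) / 2)

/-- The matrix variate t distribution `t_{n,n}(ν, M, Ω₁, Ω₂)`. -/
noncomputable def matrixT {n : ℕ} (ν : ℝ) (M Ω₁ Ω₂ : Matrix (Fin n) (Fin n) ℝ) :
    Measure (Matrix (Fin n) (Fin n) ℝ) :=
  volume.withDensity fun X => ENNReal.ofReal (matrixTPDF ν M Ω₁ Ω₂ X)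

end MatrixT

/-! The joint density of $(W,Y)$ is a constant times $|w|^{-a-(n+1)/2}\,\mathrm{etr}(-\tfrac12\Psi_y
w^{-1})$ with $a=(\nu+2n-1)/2$ and $\Psi_y=\Sigma_1+(y-B)\Sigma_2^{-1}(y-B)'$
(`invMatrixGammaPDF_mul_matrixNormalPDF`). Writing $\Psi_y=gg'$ and substituting $w\mapsto gwg'$,
whose Jacobian is $|\det g|^{n+1}$, the $w$-integral equals $|\Psi_y|^{-a}$ times a number
independent of $y$ (`invGammaIntegral_eq`). Hence $Y$ has density
$K\,|I+\Sigma_1^{-1}(y-B)\Sigma_2^{-1}(y-B)'|^{-a}$.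

The multivariate gamma integral over the positive definite cone is never evaluated. Since the law of
$Y$ has mass one, $K$ is the reciprocal of the integral of the $t$ kernel. That integral
(`lintegral_det_one_add_rpow`) reduces to $\int|A+X'X|^{-a}dX$, where rows of $X$ are integrated out
one at a time, each contributing a ratio of ordinary gamma values. -/

namespace MatrixT

/-! ### Jacobians of $x\mapsto gx$ and $x\mapsto gxg'$. -/

/-- A multiplicative real-valued function of square matrices is a power of the determinant as soon
as it is so on diagonal matrices. -/
theorem monoidHom_eq_det_pow {n : ℕ} (f : Matrix (Fin n) (Fin n) ℝ →* ℝ) (k : ℕ)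
    (hf : ∀ D, f (Matrix.diagonal D) = (∏ i, D i) ^ k) {g : Matrix (Fin n) (Fin n) ℝ}
    (hg : g.det ≠ 0) : f g = g.det ^ k := by
  refine Matrix.diagonal_transvection_induction_of_det_ne_zero
    (fun g => f g = g.det ^ k) g hg ?_ ?_ ?_
  · intro D _
    rw [hf, Matrix.det_diagonal]
  · rintro ⟨i, j, hij, c⟩
    simp only [Matrix.TransvectionStruct.toMatrix_mk, Matrix.det_transvection_of_ne i j hij c,
      one_pow]
    have hne : f (Matrix.transvection i j c) ≠ 0 := by
      intro h0
      have := f.map_mul (Matrix.transvection i j c) (Matrix.transvection i j (-c))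
      rw [Matrix.transvection_mul_transvection_same _ _ hij, h0] at this
      simp at this
    -- Conjugation by a diagonal matrix with a single entry 2 doubles the parameter of the
    -- transvection $T$, so $f(T)=f(T)^2$. As $f(T)\neq0$, $f(T)=1$.
    have hcomm : Matrix.diagonal (Function.update (1 : Fin n → ℝ) i 2) * Matrix.transvection i j c
        = Matrix.transvection i j (c + c) *
          Matrix.diagonal (Function.update (1 : Fin n → ℝ) i 2) := by
      ext a b
      rw [Matrix.diagonal_mul, Matrix.mul_diagonal]
      simp only [Matrix.transvection, Matrix.add_apply, Matrix.single_apply, Matrix.one_apply,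
        Function.update_apply, Pi.one_apply]
      grind
    have h2 : f (Matrix.diagonal (Function.update (1 : Fin n → ℝ) i 2)) ≠ 0 := by
      rw [hf]
      refine pow_ne_zero _ (Finset.prod_ne_zero_iff.2 fun a _ => ?_)
      rw [Function.update_apply]
      split_ifs <;> norm_num
    have key := congrArg f hcomm
    rw [← Matrix.transvection_mul_transvection_same _ _ hij, map_mul, map_mul, map_mul,
      mul_comm _ (f (Matrix.diagonal _))] at key
    have := mul_left_cancel₀ h2 key
    field_simp at this
    exact this.symm
  · intro A B _ _ hA hB
    rw [map_mul, hA, hB, Matrix.det_mul, mul_pow]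

/-- Left multiplication by `g` as a linear map of the coordinate space of square matrices. -/
def mulLeftLinear {n : ℕ} (g : Matrix (Fin n) (Fin n) ℝ) :
    (Fin n → Fin n → ℝ) →ₗ[ℝ] (Fin n → Fin n → ℝ) where
  toFun x := (g * Matrix.of x : Matrix (Fin n) (Fin n) ℝ)
  map_add' x y := Matrix.mul_add g (Matrix.of x) (Matrix.of y)
  map_smul' c x := Matrix.mul_smul g c (Matrix.of x)

theorem det_mulLeftLinear {n : ℕ} {g : Matrix (Fin n) (Fin n) ℝ} (hg : g.det ≠ 0) :
    LinearMap.det (mulLeftLinear g) = g.det ^ n := by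
  refine monoidHom_eq_det_pow (f := ⟨⟨fun g => LinearMap.det (mulLeftLinear g), ?_⟩, ?_⟩) n ?_ hg
  · have : mulLeftLinear (1 : Matrix (Fin n) (Fin n) ℝ) = LinearMap.id :=
      LinearMap.ext fun x => Matrix.one_mul (Matrix.of x)
    rw [this, LinearMap.det_id]
  · intro a b
    have : mulLeftLinear (a * b) = mulLeftLinear a ∘ₗ mulLeftLinear b :=
      LinearMap.ext fun x => Matrix.mul_assoc a b (Matrix.of x)
    simp only [this, LinearMap.det_comp]
  · intro D
    have : mulLeftLinear (Matrix.diagonal D) = LinearMap.pi fun i =>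
        (D i • (LinearMap.id : (Fin n → ℝ) →ₗ[ℝ] Fin n → ℝ)) ∘ₗ LinearMap.proj i := by
      refine LinearMap.ext fun x => funext fun i => funext fun j => ?_
      exact Matrix.diagonal_mul D (Matrix.of x) i j
    change LinearMap.det (mulLeftLinear (Matrix.diagonal D)) = _
    rw [this, LinearMap.det_pi]
    simp [Finset.prod_pow]

/-- The action `x ↦ g x gᵀ` on the upper triangular coordinates of a symmetric matrix. -/
def symCongr {n : ℕ} (g : Matrix (Fin n) (Fin n) ℝ) :
    ({p : Fin n × Fin n // p.1 ≤ p.2} → ℝ) →ₗ[ℝ] ({p : Fin n × Fin n // p.1 ≤ p.2} → ℝ) where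
  toFun x := fun p => (g * symMatrixOf x * gᵀ) p.1.1 p.1.2
  map_add' x y := by
    have : symMatrixOf (x + y) = symMatrixOf x + symMatrixOf y := rfl
    funext p
    simp [this, Matrix.mul_add, Matrix.add_mul]
  map_smul' c x := by
    have : symMatrixOf (c • x) = c • symMatrixOf x := rfl
    funext p
    simp [this]

theorem symMatrixOf_transpose {n : ℕ} (x : {p : Fin n × Fin n // p.1 ≤ p.2} → ℝ) :
    (symMatrixOf x)ᵀ = symMatrixOf x := by
  ext i j
  simp [symMatrixOf, min_comm, max_comm]

theorem symMatrixOf_symCongr {n : ℕ} (g : Matrix (Fin n) (Fin n) ℝ)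
    (x : {p : Fin n × Fin n // p.1 ≤ p.2} → ℝ) :
    symMatrixOf (symCongr g x) = g * symMatrixOf x * gᵀ := by
  have hs : (g * symMatrixOf x * gᵀ)ᵀ = g * symMatrixOf x * gᵀ := by
    simp [Matrix.transpose_mul, symMatrixOf_transpose, Matrix.mul_assoc]
  ext i j
  change (g * symMatrixOf x * gᵀ) (min i j) (max i j) = _
  rcases le_total i j with h | h
  · rw [min_eq_left h, max_eq_right h]
  · rw [min_eq_right h, max_eq_left h, ← Matrix.transpose_apply (g * symMatrixOf x * gᵀ), hs]

theorem symMatrixOf_injective {n : ℕ} :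
    Function.Injective (symMatrixOf : ({p : Fin n × Fin n // p.1 ≤ p.2} → ℝ) → _) := by
  intro x y h
  funext ⟨⟨i, j⟩, hij⟩
  have := congrFun (congrFun h i) j
  have hij' : i ≤ j := hij
  simpa [symMatrixOf, min_eq_left hij', max_eq_right hij'] using this

/-- The pairs with $i\le j$ and those with $j\le i$ together cover every pair once and the diagonal
twice. Each $D_i$ therefore occurs $n+1$ times. -/
theorem prod_upper_triangle {n : ℕ} (D : Fin n → ℝ) :
    ∏ p : {p : Fin n × Fin n // p.1 ≤ p.2}, D p.1.1 * D p.1.2 = (∏ i, D i) ^ (n + 1) := by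
  calc ∏ p : {p : Fin n × Fin n // p.1 ≤ p.2}, D p.1.1 * D p.1.2
      = ∏ p : Fin n × Fin n, if p.1 ≤ p.2 then D p.1 * D p.2 else 1 := by
        rw [← Finset.prod_filter, Finset.prod_subtype (p := fun p : Fin n × Fin n => p.1 ≤ p.2)
          (F := inferInstance) (f := fun p => D p.1 * D p.2)]
        simp
    _ = ∏ i, ∏ j, (if i ≤ j then D i else 1) * (if i ≤ j then D j else 1) := by
        rw [Fintype.prod_prod_type]
        refine Finset.prod_congr rfl fun i _ => Finset.prod_congr rfl fun j _ => ?_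
        split_ifs <;> simp
    _ = (∏ i, ∏ j, (if i ≤ j then D i else 1)) * ∏ i, ∏ j, (if j ≤ i then D i else 1) := by
        rw [Finset.prod_comm (f := fun i j => if j ≤ i then D i else 1)]
        simp only [Finset.prod_mul_distrib]
    _ = ∏ i, ∏ j, D i * (if i = j then D i else 1) := by
        simp only [← Finset.prod_mul_distrib]
        refine Finset.prod_congr rfl fun i _ => Finset.prod_congr rfl fun j _ => ?_
        grind
    _ = (∏ i, D i) ^ (n + 1) := by
        simp only [Finset.prod_mul_distrib, Finset.prod_const, Finset.prod_ite_eq,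
          Finset.mem_univ, if_true, Finset.card_univ, Fintype.card_fin, Finset.prod_pow, pow_succ]

/-- By multiplicativity only diagonal $g$ matters, and there coordinate $(i,j)$ is scaled by
$D_iD_j$. -/
theorem det_symCongr {n : ℕ} {g : Matrix (Fin n) (Fin n) ℝ} (hg : g.det ≠ 0) :
    LinearMap.det (symCongr g) = g.det ^ (n + 1) := by
  refine monoidHom_eq_det_pow (f := ⟨⟨fun g => LinearMap.det (symCongr g), ?_⟩, ?_⟩) (n + 1) ?_ hg
  · have : symCongr (1 : Matrix (Fin n) (Fin n) ℝ) = LinearMap.id := by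
      refine LinearMap.ext fun x => symMatrixOf_injective ?_
      simp [symMatrixOf_symCongr]
    rw [this, LinearMap.det_id]
  · intro a b
    have : symCongr (a * b) = symCongr a ∘ₗ symCongr b := by
      refine LinearMap.ext fun x => symMatrixOf_injective ?_
      simp [symMatrixOf_symCongr, Matrix.mul_assoc]
    simp only [this, LinearMap.det_comp]
  · intro D
    have : symCongr (Matrix.diagonal D) = Matrix.toLin' (Matrix.diagonal fun
        p : {p : Fin n × Fin n // p.1 ≤ p.2} => D p.1.1 * D p.1.2) := by
      refine LinearMap.ext fun x => funext fun p => ?_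
      obtain ⟨⟨i, j⟩, hij⟩ := p
      have hij' : i ≤ j := hij
      rw [Matrix.toLin'_apply, Matrix.mulVec_diagonal]
      change (Matrix.diagonal D * symMatrixOf x * (Matrix.diagonal D)ᵀ) i j = _
      rw [Matrix.diagonal_transpose, Matrix.mul_diagonal, Matrix.diagonal_mul]
      simp only [symMatrixOf, Matrix.of_apply, min_eq_left hij', max_eq_right hij']
      ring
    change LinearMap.det (symCongr (Matrix.diagonal D)) = _
    rw [this, LinearMap.det_toLin', Matrix.det_diagonal, prod_upper_triangle]

/-! ### Linear changes of variables in Lebesgue integrals. -/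

/-- A positive definite real matrix is `g gᵀ` with `g` invertible. -/
theorem exists_mul_transpose_of_posDef {n : ℕ} {A : Matrix (Fin n) (Fin n) ℝ} (hA : A.PosDef) :
    ∃ g : Matrix (Fin n) (Fin n) ℝ, g.det ≠ 0 ∧ A = g * gᵀ := by
  open scoped MatrixOrder in
  obtain ⟨B, hB⟩ := CStarAlgebra.nonneg_iff_eq_star_mul_self.mp hA.posSemidef.nonneg
  rw [Matrix.star_eq_conjTranspose, Matrix.conjTranspose_eq_transpose_of_trivial] at hB
  refine ⟨Bᵀ, fun h => hA.det_pos.ne' ?_, by rw [hB, Matrix.transpose_transpose]⟩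
  rw [hB, Matrix.det_mul, h, zero_mul]

/-- Linear change of variables in a Lebesgue integral. -/
theorem lintegral_comp_linearMap {E : Type*} [NormedAddCommGroup E] [NormedSpace ℝ E]
    [MeasurableSpace E] [BorelSpace E] [FiniteDimensional ℝ E] (μ : Measure E)
    [μ.IsAddHaarMeasure] {f : E →ₗ[ℝ] E} (hf : LinearMap.det f ≠ 0) {F : E → ENNReal}
    (hF : Measurable F) :
    ∫⁻ x, F x ∂μ = ENNReal.ofReal |LinearMap.det f| * ∫⁻ x, F (f x) ∂μ := by
  have hm : Measurable f := f.continuous_of_finiteDimensional.measurable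
  rw [← lintegral_map hF hm, Measure.map_linearMap_addHaar_eq_smul_addHaar μ hf,
    lintegral_smul_measure, smul_eq_mul, ← mul_assoc, ← ENNReal.ofReal_mul (abs_nonneg _),
    ← abs_mul, mul_inv_cancel₀ hf, abs_one, ENNReal.ofReal_one, one_mul]

theorem measurable_symMatrixOf {n : ℕ} :
    Measurable (symMatrixOf : ({p : Fin n × Fin n // p.1 ≤ p.2} → ℝ) → _) :=
  measurable_pi_iff.2 fun _ => measurable_pi_iff.2 fun _ => measurable_pi_apply _

theorem lintegral_symVolume_congr {n : ℕ} {g : Matrix (Fin n) (Fin n) ℝ} (hg : g.det ≠ 0)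
    {F : Matrix (Fin n) (Fin n) ℝ → ENNReal} (hF : Measurable F) :
    ∫⁻ w, F w ∂symVolume n =
      ENNReal.ofReal (|g.det| ^ (n + 1)) * ∫⁻ w, F (g * w * gᵀ) ∂symVolume n := by
  have hc : Continuous fun w : Matrix (Fin n) (Fin n) ℝ => g * w * gᵀ := by fun_prop
  rw [symVolume, lintegral_map hF measurable_symMatrixOf,
    lintegral_map (f := fun w => F (g * w * gᵀ)) (hF.comp hc.measurable) measurable_symMatrixOf,
    lintegral_comp_linearMap volume (f := symCongr g) (F := fun x => F (symMatrixOf x))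
      (by rw [det_symCongr hg]; exact pow_ne_zero _ hg) (hF.comp measurable_symMatrixOf)]
  simp only [symMatrixOf_symCongr, det_symCongr hg, abs_pow]

theorem lintegral_mul_left {n : ℕ} {g : Matrix (Fin n) (Fin n) ℝ} (hg : g.det ≠ 0)
    {F : Matrix (Fin n) (Fin n) ℝ → ENNReal} (hF : Measurable F) :
    ∫⁻ x, F x = ENNReal.ofReal (|g.det| ^ n) * ∫⁻ x, F (g * x) := by
  have := lintegral_comp_linearMap (volume : Measure (Fin n → Fin n → ℝ)) (f := mulLeftLinear g)
      (by rw [det_mulLeftLinear hg]; exact pow_ne_zero _ hg) (F := F) hF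
  rw [det_mulLeftLinear hg, abs_pow] at this
  exact this

theorem lintegral_sub_right {n : ℕ} (B : Matrix (Fin n) (Fin n) ℝ)
    (F : Matrix (Fin n) (Fin n) ℝ → ENNReal) :
    ∫⁻ x, F (x - B) = ∫⁻ x, F x :=
  lintegral_sub_right_eq_self (μ := (volume : Measure (Fin n → Fin n → ℝ))) F B

/-! ### Gamma, Gaussian and Student type integrals. -/

theorem lintegral_rpow_mul_exp_neg_mul_Ioi {a r : ℝ} (ha : 0 < a) (hr : 0 < r) :
    ∫⁻ t in Set.Ioi (0 : ℝ), ENNReal.ofReal (t ^ (a - 1) * Real.exp (-(r * t))) =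
      ENNReal.ofReal (r ^ (-a) * Real.Gamma a) := by
  have h := Real.integral_rpow_mul_exp_neg_mul_Ioi ha hr
  have hpos : 0 < (1 / r) ^ a * Real.Gamma a :=
    mul_pos (Real.rpow_pos_of_pos (by positivity) _) (Real.Gamma_pos_of_pos ha)
  rw [← ofReal_integral_eq_lintegral_ofReal, h, one_div, Real.inv_rpow hr.le, Real.rpow_neg hr.le]
  -- A Bochner integral defaults to 0 for a non-integrable function, so a nonzero value proves
  -- integrability.
  · exact not_imp_comm.1 integral_undef (by rw [h]; exact hpos.ne')
  · filter_upwards [ae_restrict_mem measurableSet_Ioi] with t ht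
    have : (0 : ℝ) < t := ht
    simp only [Pi.zero_apply]
    positivity

theorem lintegral_exp_neg_mul_dotProduct {n : ℕ} {t : ℝ} (ht : 0 < t) :
    ∫⁻ v : Fin n → ℝ, ENNReal.ofReal (Real.exp (-(t * (v ⬝ᵥ v)))) =
      ENNReal.ofReal ((Real.pi / t) ^ ((n : ℝ) / 2)) := by
  have h : ∫ v : Fin n → ℝ, Real.exp (-(t * (v ⬝ᵥ v))) = (Real.pi / t) ^ ((n : ℝ) / 2) := by
    have h1 : ∀ v : Fin n → ℝ, Real.exp (-(t * (v ⬝ᵥ v))) = ∏ i, Real.exp (-t * v i ^ 2) := by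
      intro v
      rw [← Real.exp_sum, dotProduct, Finset.mul_sum, ← Finset.sum_neg_distrib]
      refine congrArg _ (Finset.sum_congr rfl fun i _ => by ring)
    simp_rw [h1]
    rw [integral_fintype_prod_volume_eq_pow (fun x : ℝ => Real.exp (-t * x ^ 2)),
      integral_gaussian, Fintype.card_fin, Real.sqrt_eq_rpow, ← Real.rpow_natCast,
      ← Real.rpow_mul (by positivity)]
    congr 1
    ring
  have hpos : 0 < (Real.pi / t) ^ ((n : ℝ) / 2) :=
    Real.rpow_pos_of_pos (div_pos Real.pi_pos ht) _
  rw [← ofReal_integral_eq_lintegral_ofReal, h]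
  · exact not_imp_comm.1 integral_undef (by rw [h]; exact hpos.ne')
  · exact Filter.Eventually.of_forall fun v => (Real.exp_pos _).le

/-- The normalizing constant of the density `(1 + |v|²)^(-a)` on `ℝⁿ`. -/
noncomputable def studentConst (n : ℕ) (a : ℝ) : ℝ :=
  Real.pi ^ ((n : ℝ) / 2) * Real.Gamma (a - n / 2) / Real.Gamma a

/-- Write $\Gamma(a)(1+|v|^2)^{-a}=\int_0^\infty t^{a-1}e^{-(1+|v|^2)t}dt$ and exchange integrals.
The Gaussian integral in $v$ gives $(\pi/t)^{n/2}$, and what remains is $\Gamma(a-n/2)$, which needs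
$a>n/2$. -/
theorem lintegral_one_add_dotProduct_rpow {n : ℕ} {a : ℝ} (ha : (n : ℝ) / 2 < a) :
    ∫⁻ v : Fin n → ℝ, ENNReal.ofReal ((1 + v ⬝ᵥ v) ^ (-a)) =
      ENNReal.ofReal (studentConst n a) := by
  have ha0 : 0 < a := lt_of_le_of_lt (by positivity) ha
  have hΓ := Real.Gamma_pos_of_pos ha0
  have hq : ∀ v : Fin n → ℝ, 0 < 1 + v ⬝ᵥ v := fun v => by
    have : 0 ≤ v ⬝ᵥ v := Finset.sum_nonneg fun i _ => mul_self_nonneg _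
    linarith
  have hmeas : Measurable fun p : (Fin n → ℝ) × ℝ =>
      ENNReal.ofReal (p.2 ^ (a - 1) * Real.exp (-((1 + p.1 ⬝ᵥ p.1) * p.2))) := by
    have : Continuous fun p : (Fin n → ℝ) × ℝ => -((1 + p.1 ⬝ᵥ p.1) * p.2) := by fun_prop
    exact ((measurable_snd.pow_const _).mul this.measurable.exp).ennreal_ofReal
  have key : (∫⁻ v : Fin n → ℝ, ENNReal.ofReal ((1 + v ⬝ᵥ v) ^ (-a))) *
      ENNReal.ofReal (Real.Gamma a) =
      ENNReal.ofReal (Real.pi ^ ((n : ℝ) / 2) * Real.Gamma (a - n / 2)) := by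
    rw [← lintegral_mul_const' _ _ ENNReal.ofReal_ne_top]
    calc ∫⁻ v : Fin n → ℝ, ENNReal.ofReal ((1 + v ⬝ᵥ v) ^ (-a)) * ENNReal.ofReal (Real.Gamma a)
        = ∫⁻ v : Fin n → ℝ, ∫⁻ t in Set.Ioi (0 : ℝ),
            ENNReal.ofReal (t ^ (a - 1) * Real.exp (-((1 + v ⬝ᵥ v) * t))) := by
          refine lintegral_congr fun v => ?_
          rw [lintegral_rpow_mul_exp_neg_mul_Ioi ha0 (hq v), ENNReal.ofReal_mul
            (Real.rpow_nonneg (hq v).le _)]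
      _ = ∫⁻ t in Set.Ioi (0 : ℝ), ∫⁻ v : Fin n → ℝ,
            ENNReal.ofReal (t ^ (a - 1) * Real.exp (-((1 + v ⬝ᵥ v) * t))) :=
          lintegral_lintegral_swap hmeas.aemeasurable
      _ = ∫⁻ t in Set.Ioi (0 : ℝ), ENNReal.ofReal (Real.pi ^ ((n : ℝ) / 2)) *
            ENNReal.ofReal (t ^ (a - n / 2 - 1) * Real.exp (-(1 * t))) := by
          refine setLIntegral_congr_fun measurableSet_Ioi fun t ht => ?_
          have ht0 : (0 : ℝ) < t := ht
          have h1 : ∀ v : Fin n → ℝ, t ^ (a - 1) * Real.exp (-((1 + v ⬝ᵥ v) * t)) =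
              t ^ (a - 1) * Real.exp (-t) * Real.exp (-(t * (v ⬝ᵥ v))) := by
            intro v
            rw [mul_assoc, ← Real.exp_add]
            congr 2
            ring
          have h2 : (0 : ℝ) ≤ t ^ (a - 1) * Real.exp (-t) := by positivity
          simp only [h1, ENNReal.ofReal_mul h2]
          rw [lintegral_const_mul' _ _ ENNReal.ofReal_ne_top,
            lintegral_exp_neg_mul_dotProduct ht0, ← ENNReal.ofReal_mul h2,
            ← ENNReal.ofReal_mul (by positivity), Real.div_rpow Real.pi_pos.le ht0.le,
            show a - n / 2 - 1 = (a - 1) - n / 2 by ring, Real.rpow_sub ht0 (a - 1), one_mul]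
          congr 1
          ring
      _ = _ := by
          rw [lintegral_const_mul' _ _ ENNReal.ofReal_ne_top,
            lintegral_rpow_mul_exp_neg_mul_Ioi (by linarith) one_pos, Real.one_rpow, one_mul,
            ← ENNReal.ofReal_mul (by positivity)]
  rw [studentConst, ENNReal.ofReal_div_of_pos hΓ, ← key]
  refine (ENNReal.mul_div_cancel_right ?_ ENNReal.ofReal_ne_top).symm
  simpa using hΓ

theorem studentConst_pos {n : ℕ} {a : ℝ} (ha : (n : ℝ) / 2 < a) : 0 < studentConst n a := by
  have ha0 : 0 < a := lt_of_le_of_lt (by positivity) ha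
  exact div_pos (mul_pos (by positivity) (Real.Gamma_pos_of_pos (by linarith)))
    (Real.Gamma_pos_of_pos ha0)

/-- With $A=gg'$ and $v=gu$, the rank-one determinant formula gives $|A|(1+|u|^2)$. The Jacobian
$|\det g|=|A|^{1/2}$ shifts the exponent of $|A|$ by one half. -/
theorem lintegral_det_add_vecMulVec_rpow {n : ℕ} {a : ℝ} (ha : (n : ℝ) / 2 < a)
    {A : Matrix (Fin n) (Fin n) ℝ} (hA : A.PosDef) :
    ∫⁻ v : Fin n → ℝ, ENNReal.ofReal ((A + Matrix.vecMulVec v v).det ^ (-a)) =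
      ENNReal.ofReal (A.det ^ (-(a - 1 / 2)) * studentConst n a) := by
  have hpos := hA.det_pos
  obtain ⟨g, hg, rfl⟩ := exists_mul_transpose_of_posDef hA
  have hdet : ∀ u : Fin n → ℝ,
      (g * gᵀ + Matrix.vecMulVec (g *ᵥ u) (g *ᵥ u)).det = (g * gᵀ).det * (1 + u ⬝ᵥ u) := by
    intro u
    have h1 : g * gᵀ + Matrix.vecMulVec (g *ᵥ u) (g *ᵥ u) =
        g * (1 + Matrix.vecMulVec u u) * gᵀ := by
      rw [Matrix.mul_add, Matrix.add_mul, Matrix.mul_one, Matrix.mul_vecMulVec,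
        Matrix.vecMulVec_mul, Matrix.vecMul_transpose]
    have h2 : (1 + Matrix.vecMulVec u u).det = 1 + u ⬝ᵥ u := by
      rw [Matrix.vecMulVec_eq Unit, Matrix.det_one_add_replicateCol_mul_replicateRow]
    rw [h1, Matrix.det_mul, Matrix.det_mul, h2, Matrix.det_mul]
    ring
  have hq : ∀ v : Fin n → ℝ, 0 ≤ 1 + v ⬝ᵥ v := fun v => by
    have : 0 ≤ v ⬝ᵥ v := Finset.sum_nonneg fun i _ => mul_self_nonneg _
    linarith
  have hm : Measurable fun v : Fin n → ℝ =>
      ENNReal.ofReal ((g * gᵀ + Matrix.vecMulVec v v).det ^ (-a)) := by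
    have : Continuous fun v : Fin n → ℝ => (g * gᵀ + Matrix.vecMulVec v v).det := by fun_prop
    exact (this.measurable.pow_const _).ennreal_ofReal
  rw [lintegral_comp_linearMap volume (f := Matrix.toLin' g) (by rwa [LinearMap.det_toLin']) hm]
  simp only [Matrix.toLin'_apply, hdet, LinearMap.det_toLin']
  have h3 : ∀ v : Fin n → ℝ, ENNReal.ofReal (((g * gᵀ).det * (1 + v ⬝ᵥ v)) ^ (-a)) =
      ENNReal.ofReal ((g * gᵀ).det ^ (-a)) * ENNReal.ofReal ((1 + v ⬝ᵥ v) ^ (-a)) := by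
    intro v
    rw [Real.mul_rpow hpos.le (hq v), ENNReal.ofReal_mul (by positivity)]
  simp only [h3]
  rw [lintegral_const_mul' _ _ ENNReal.ofReal_ne_top, lintegral_one_add_dotProduct_rpow ha,
    ← ENNReal.ofReal_mul (by positivity), ← ENNReal.ofReal_mul (by positivity)]
  have habs : |g.det| = (g * gᵀ).det ^ (1 / 2 : ℝ) := by
    rw [Matrix.det_mul, Matrix.det_transpose, ← Real.sqrt_eq_rpow, ← sq, Real.sqrt_sq_eq_abs]
  rw [habs, ← mul_assoc, ← Real.rpow_add hpos]
  congr 3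
  ring

/-! ### Integrating $|A+X'X|^{-a}$ row by row. -/

theorem posDef_add_transpose_mul_self {k n : ℕ} {A : Matrix (Fin n) (Fin n) ℝ} (hA : A.PosDef)
    (X : Matrix (Fin k) (Fin n) ℝ) : (A + Xᵀ * X).PosDef := by
  have := Matrix.posSemidef_conjTranspose_mul_self X
  rw [Matrix.conjTranspose_eq_transpose_of_trivial] at this
  exact hA.add_posSemidef this

/-- Integral of a power of `det (A + XᵀX)` over rectangular matrices, by splitting off one row at a
time. -/
theorem lintegral_det_add_transpose_mul_self_rpow {n : ℕ} {A : Matrix (Fin n) (Fin n) ℝ}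
    (hA : A.PosDef) (k : ℕ) : ∀ a : ℝ, (∀ i < k, (n : ℝ) / 2 < a - i / 2) →
    ∫⁻ X : Fin k → Fin n → ℝ, ENNReal.ofReal ((A + (Matrix.of X)ᵀ * Matrix.of X).det ^ (-a)) =
      ENNReal.ofReal (A.det ^ (-(a - k / 2)) *
        ∏ i ∈ Finset.range k, studentConst n (a - i / 2)) := by
  induction k with
  | zero =>
    intro a _
    simp [volume_pi]
  | succ k ih =>
    intro a ha
    have hm : ∀ b : ℝ, Measurable fun p : (Fin n → ℝ) × (Fin k → Fin n → ℝ) =>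
        ENNReal.ofReal ((A + (Matrix.of p.2)ᵀ * Matrix.of p.2 +
          Matrix.vecMulVec p.1 p.1).det ^ b) := by
      intro b
      have : Continuous fun p : (Fin n → ℝ) × (Fin k → Fin n → ℝ) =>
        (A + (Matrix.of p.2)ᵀ * Matrix.of p.2 + Matrix.vecMulVec p.1 p.1).det := by fun_prop
      exact (this.measurable.pow_const _).ennreal_ofReal
    have hsplit : ∀ p : (Fin n → ℝ) × (Fin k → Fin n → ℝ),
        A + (Matrix.of (Fin.consEquiv (fun _ : Fin (k + 1) => Fin n → ℝ) p))ᵀ *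
          Matrix.of (Fin.consEquiv (fun _ : Fin (k + 1) => Fin n → ℝ) p) =
        A + (Matrix.of p.2)ᵀ * Matrix.of p.2 + Matrix.vecMulVec p.1 p.1 := by
      intro p
      rw [add_assoc]
      congr 1
      ext i j
      simp [Matrix.mul_apply, Fin.sum_univ_succ, Matrix.vecMulVec_apply, add_comm]
    have hmp := (volume_preserving_piFinSuccAbove (fun _ : Fin (k + 1) => Fin n → ℝ) 0).symm
    have ha0 : (n : ℝ) / 2 < a := by simpa using ha 0 (Nat.succ_pos k)
    rw [← hmp.lintegral_comp_emb (MeasurableEquiv.measurableEmbedding _)]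
    simp only [MeasurableEquiv.piFinSuccAbove_symm_apply, Fin.insertNthEquiv_zero,
      hsplit]
    rw [Measure.volume_eq_prod, lintegral_prod_symm' _ (hm (-a))]
    -- Integrating out the first row leaves the same integrand in the other rows with $a-\tfrac12$
    -- for $a$, which is why the induction keeps $a$ general.
    have hstep : ∀ X : Fin k → Fin n → ℝ,
        ∫⁻ v : Fin n → ℝ, ENNReal.ofReal ((A + (Matrix.of X)ᵀ * Matrix.of X +
          Matrix.vecMulVec v v).det ^ (-a)) =
        ENNReal.ofReal ((A + (Matrix.of X)ᵀ * Matrix.of X).det ^ (-(a - 1 / 2))) *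
          ENNReal.ofReal (studentConst n a) := by
      intro X
      have hX := posDef_add_transpose_mul_self hA (Matrix.of X)
      rw [lintegral_det_add_vecMulVec_rpow ha0 hX,
        ENNReal.ofReal_mul (Real.rpow_nonneg hX.det_pos.le _)]
    simp only [hstep]
    rw [lintegral_mul_const' _ _ ENNReal.ofReal_ne_top, ih (a - 1 / 2), ← ENNReal.ofReal_mul',
      Finset.prod_range_succ', mul_assoc]
    · congr 2
      · congr 1
        push_cast
        ring
      · congr 1
        · refine Finset.prod_congr rfl fun i _ => ?_
          congr 1
          push_cast
          ring
        · simp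
    · exact (studentConst_pos ha0).le
    · intro i hi
      have := ha (i + 1) (by omega)
      push_cast at this
      linarith

/-- The arguments $a-i/2$ are exactly those in the multivariate gamma function, and its
power-of-$\pi$ prefactor cancels in the quotient. -/
theorem prod_studentConst {n : ℕ} {a : ℝ} :
    ∏ i ∈ Finset.range n, studentConst n (a - i / 2) =
      Real.pi ^ ((n : ℝ) ^ 2 / 2) * multiGamma n (a - n / 2) / multiGamma n a := by
  have h : ∏ i ∈ Finset.range n, Real.pi ^ ((n : ℝ) / 2) = Real.pi ^ ((n : ℝ) ^ 2 / 2) := by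
    rw [Finset.prod_const, Finset.card_range, ← Real.rpow_natCast, ← Real.rpow_mul Real.pi_pos.le]
    congr 1
    ring
  have hne : Real.pi ^ ((n : ℝ) * ((n : ℝ) - 1) / 4) ≠ 0 := by positivity
  simp only [studentConst, multiGamma, Finset.prod_div_distrib, Finset.prod_mul_distrib, h]
  rw [mul_left_comm, mul_div_mul_left _ _ hne]
  congr 2
  refine Finset.prod_congr rfl fun i _ => ?_
  congr 1
  ring

/-! ### Measurability and $\sigma$-finiteness. -/

instance {n : ℕ} : SFinite (symVolume n) :=
  inferInstanceAs (SFinite (Measure.map _ _))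

instance {m n : ℕ} : SFinite (volume : Measure (Matrix (Fin m) (Fin n) ℝ)) :=
  inferInstanceAs (SFinite (volume : Measure (Fin m → Fin n → ℝ)))

instance {m n : ℕ} : SecondCountableTopology (Matrix (Fin m) (Fin n) ℝ) :=
  inferInstanceAs (SecondCountableTopology (Fin m → Fin n → ℝ))

theorem measurable_matrix_inv {n : ℕ} :
    Measurable fun W : Matrix (Fin n) (Fin n) ℝ => W⁻¹ := by
  refine measurable_pi_iff.2 fun i => measurable_pi_iff.2 fun j => ?_
  simp only [Matrix.inv_def, Ring.inverse_eq_inv', Matrix.smul_apply, smul_eq_mul]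
  have h1 : Continuous fun W : Matrix (Fin n) (Fin n) ℝ => W.det := by fun_prop
  have h2 : Continuous fun W : Matrix (Fin n) (Fin n) ℝ => W.adjugate i j :=
    (Continuous.matrix_adjugate continuous_id).matrix_elem i j
  exact h1.measurable.inv.mul h2.measurable

theorem measurableSet_posDef {n : ℕ} :
    MeasurableSet {W : Matrix (Fin n) (Fin n) ℝ | W.PosDef} := by
  -- The positive definite cone is the closed positive semidefinite cone minus the closed set of
  -- singular matrices.
  have h : {W : Matrix (Fin n) (Fin n) ℝ | W.PosDef} =
      ({W | Wᵀ = W} ∩ ⋂ x : Fin n → ℝ, {W | 0 ≤ x ⬝ᵥ (W *ᵥ x)}) ∩ {W | W.det = 0}ᶜ := by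
    ext W
    have hW : W.PosSemidef ↔ Wᵀ = W ∧ ∀ x : Fin n → ℝ, 0 ≤ x ⬝ᵥ (W *ᵥ x) := by
      simp [Matrix.posSemidef_iff_dotProduct_mulVec, Matrix.IsHermitian]
    simp only [Set.mem_inter_iff, Set.mem_iInter, Set.mem_compl_iff, Set.mem_ofPred_eq, ← hW]
    exact ⟨fun h => ⟨h.posSemidef, h.det_pos.ne'⟩, fun h => h.1.posDef_iff_det_ne_zero.2 h.2⟩
  rw [h]
  refine MeasurableSet.inter (IsClosed.measurableSet ?_) (IsClosed.measurableSet ?_).compl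
  · exact (isClosed_eq (by fun_prop) (by fun_prop)).inter
      (isClosed_iInter fun x => isClosed_le (by fun_prop) (by fun_prop))
  · exact isClosed_eq (by fun_prop) (by fun_prop)

theorem multiGamma_pos {p : ℕ} {z : ℝ} (h : ∀ i < p, 0 < z - (i : ℝ) / 2) :
    0 < multiGamma p z :=
  mul_pos (by positivity)
    (Finset.prod_pos fun i hi => Real.Gamma_pos_of_pos (h i (Finset.mem_range.1 hi)))

theorem measurable_det_rpow_mul_exp_trace {n : ℕ} {α : Type*} [MeasurableSpace α] (a : ℝ)
    {w f : α → Matrix (Fin n) (Fin n) ℝ} (hw : Measurable w) (hf : Measurable f) :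
    Measurable fun x => ENNReal.ofReal
      ((w x).det ^ a * Real.exp (-(1 / 2) * (f x * (w x)⁻¹).trace)) := by
  have h1 : Continuous fun W : Matrix (Fin n) (Fin n) ℝ => W.det := by fun_prop
  have h2 : Continuous fun p : Matrix (Fin n) (Fin n) ℝ × Matrix (Fin n) (Fin n) ℝ =>
    -(1 / 2) * (p.1 * p.2).trace := by fun_prop
  exact (((h1.measurable.comp hw).pow_const _).mul
    (h2.measurable.comp (hf.prodMk (measurable_matrix_inv.comp hw))).exp).ennreal_ofReal

/-! ### Scaling of the inverted gamma integral. -/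

/-- The unnormalized total mass of the inverted matrix variate gamma density with scale `Ψ`. -/
noncomputable def invGammaIntegral {n : ℕ} (a : ℝ) (Ψ : Matrix (Fin n) (Fin n) ℝ) : ENNReal :=
  ∫⁻ w in {w | w.PosDef}, ENNReal.ofReal
    (w.det ^ (-a - ((n : ℝ) + 1) / 2) * Real.exp (-(1 / 2) * (Ψ * w⁻¹).trace)) ∂symVolume n

/-- Substitute $w\mapsto gwg'$ with $\Psi=gg'$: the cone is preserved, the trace becomes
$\mathrm{tr}\,w^{-1}$, and the Jacobian $|\Psi|^{(n+1)/2}$ cancels part of $|\Psi|^{-a-(n+1)/2}$.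
The value at the identity stays unevaluated; even its finiteness is not needed here. -/
theorem invGammaIntegral_eq {n : ℕ} (a : ℝ) {Ψ : Matrix (Fin n) (Fin n) ℝ} (hΨ : Ψ.PosDef) :
    invGammaIntegral a Ψ = ENNReal.ofReal (Ψ.det ^ (-a)) *
      invGammaIntegral a (1 : Matrix (Fin n) (Fin n) ℝ) := by
  have hpos := hΨ.det_pos
  obtain ⟨g, hg, rfl⟩ := exists_mul_transpose_of_posDef hΨ
  have hu : IsUnit g := (Matrix.isUnit_iff_isUnit_det g).2 hg.isUnit
  have hpd : ∀ w : Matrix (Fin n) (Fin n) ℝ, (g * w * gᵀ).PosDef ↔ w.PosDef := by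
    intro w
    have := Matrix.IsUnit.posDef_star_right_conjugate_iff (x := w) hu
    rwa [Matrix.star_eq_conjTranspose, Matrix.conjTranspose_eq_transpose_of_trivial] at this
  have htr : ∀ w : Matrix (Fin n) (Fin n) ℝ,
      (g * gᵀ * (g * w * gᵀ)⁻¹).trace = (1 * w⁻¹).trace := by
    intro w
    have hgt : IsUnit gᵀ.det := by rw [Matrix.det_transpose]; exact hg.isUnit
    rw [Matrix.mul_inv_rev, Matrix.mul_inv_rev, Matrix.mul_assoc,
      Matrix.mul_nonsing_inv_cancel_left _ _ hgt, ← Matrix.mul_assoc, Matrix.trace_mul_comm,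
      Matrix.nonsing_inv_mul_cancel_left _ _ hg.isUnit, Matrix.one_mul]
  have hdet : ∀ w : Matrix (Fin n) (Fin n) ℝ, (g * w * gᵀ).det = (g * gᵀ).det * w.det := by
    intro w
    simp only [Matrix.det_mul]
    ring
  have habs : |g.det| ^ (n + 1) = (g * gᵀ).det ^ (((n : ℝ) + 1) / 2) := by
    have : |g.det| = (g * gᵀ).det ^ (1 / 2 : ℝ) := by
      rw [Matrix.det_mul, Matrix.det_transpose, ← Real.sqrt_eq_rpow, ← sq, Real.sqrt_sq_eq_abs]
    rw [this, ← Real.rpow_natCast, ← Real.rpow_mul hpos.le]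
    congr 1
    push_cast
    ring
  have hm : Measurable fun w : Matrix (Fin n) (Fin n) ℝ => ENNReal.ofReal
      (w.det ^ (-a - ((n : ℝ) + 1) / 2) * Real.exp (-(1 / 2) * (g * gᵀ * w⁻¹).trace)) :=
    measurable_det_rpow_mul_exp_trace _ measurable_id measurable_const
  rw [invGammaIntegral, ← lintegral_indicator measurableSet_posDef,
    lintegral_symVolume_congr hg (hm.indicator measurableSet_posDef), habs, invGammaIntegral,
      ← lintegral_indicator measurableSet_posDef, ← lintegral_const_mul' _ _ ENNReal.ofReal_ne_top,
      ← lintegral_const_mul' _ _ ENNReal.ofReal_ne_top]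
  refine lintegral_congr fun w => ?_
  by_cases hw : w.PosDef
  · rw [Set.indicator_of_mem (by exact (hpd w).2 hw), Set.indicator_of_mem (by exact hw), htr,
      ← ENNReal.ofReal_mul (by positivity), ← ENNReal.ofReal_mul (by positivity), hdet,
      Real.mul_rpow hpos.le hw.det_pos.le, ← mul_assoc, ← mul_assoc, ← Real.rpow_add hpos,
      ← mul_assoc]
    congr 4
    ring
  · rw [Set.indicator_of_notMem (by exact fun h => hw ((hpd w).1 h)),
      Set.indicator_of_notMem (by exact hw), mul_zero, mul_zero]

/-! ### Integral of the matrix $t$ kernel. -/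

theorem posDef_add_mul_inv_mul_transpose {n : ℕ} {S₁ S₂ : Matrix (Fin n) (Fin n) ℝ}
    (hS₁ : S₁.PosDef) (hS₂ : S₂.PosDef) (X : Matrix (Fin n) (Fin n) ℝ) :
    (S₁ + X * S₂⁻¹ * Xᵀ).PosDef := by
  have := hS₂.inv.posSemidef.mul_mul_conjTranspose_same X
  rw [Matrix.conjTranspose_eq_transpose_of_trivial] at this
  exact hS₁.add_posSemidef this

theorem det_add_mul_inv_mul_transpose {n : ℕ} {S₁ : Matrix (Fin n) (Fin n) ℝ}
    (hS₁ : S₁.PosDef) (S₂ X : Matrix (Fin n) (Fin n) ℝ) :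
    (S₁ + X * S₂⁻¹ * Xᵀ).det = S₁.det * (1 + S₁⁻¹ * X * S₂⁻¹ * Xᵀ).det := by
  rw [← Matrix.det_mul, Matrix.mul_add, Matrix.mul_one]
  simp only [Matrix.mul_assoc]
  rw [Matrix.mul_nonsing_inv_cancel_left _ _ hS₁.det_pos.ne'.isUnit]

theorem det_one_add_pos {n : ℕ} {S₁ S₂ : Matrix (Fin n) (Fin n) ℝ}
    (hS₁ : S₁.PosDef) (hS₂ : S₂.PosDef) (X : Matrix (Fin n) (Fin n) ℝ) :
    0 < (1 + S₁⁻¹ * X * S₂⁻¹ * Xᵀ).det := by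
  have h := (posDef_add_mul_inv_mul_transpose hS₁ hS₂ X).det_pos
  rw [det_add_mul_inv_mul_transpose hS₁] at h
  exact (mul_pos_iff_of_pos_left hS₁.det_pos).1 h

/-- The kernel of the matrix variate t density has the expected integral. -/
theorem lintegral_det_one_add_rpow {n : ℕ} {a : ℝ} (ha : ∀ i < n, (n : ℝ) / 2 < a - i / 2)
    {S₁ S₂ : Matrix (Fin n) (Fin n) ℝ} (hS₁ : S₁.PosDef) (hS₂ : S₂.PosDef)
    (B : Matrix (Fin n) (Fin n) ℝ) :
    ∫⁻ X : Matrix (Fin n) (Fin n) ℝ,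
        ENNReal.ofReal ((1 + S₁⁻¹ * (X - B) * S₂⁻¹ * (X - B)ᵀ).det ^ (-a)) =
      ENNReal.ofReal (S₁.det ^ ((n : ℝ) / 2) * S₂.det ^ ((n : ℝ) / 2) *
        (Real.pi ^ ((n : ℝ) ^ 2 / 2) * multiGamma n (a - n / 2) / multiGamma n a)) := by
  rw [lintegral_sub_right B (fun X : Matrix (Fin n) (Fin n) ℝ =>
    ENNReal.ofReal ((1 + S₁⁻¹ * X * S₂⁻¹ * Xᵀ).det ^ (-a)))]
  have hp₁ := hS₁.det_pos
  have hp₂ := hS₂.det_pos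
  obtain ⟨h, hh, hS⟩ := exists_mul_transpose_of_posDef hS₁.inv
  have hht : hᵀ.det ≠ 0 := by rwa [Matrix.det_transpose]
  -- With $\Sigma_1^{-1}=hh'$ and $Z=h'X$, the identity $|I+PQ|=|I+QP|$ turns the kernel into a
  -- power of $|\Sigma_2+Z'Z|$, up to a power of $|\Sigma_2|$.
  have hdet : ∀ X : Matrix (Fin n) (Fin n) ℝ, (S₂ + (hᵀ * X)ᵀ * (hᵀ * X)).det =
      S₂.det * (1 + S₁⁻¹ * X * S₂⁻¹ * Xᵀ).det := by
    intro X
    have h1 : (1 + S₁⁻¹ * X * S₂⁻¹ * Xᵀ).det = (1 + S₂⁻¹ * ((hᵀ * X)ᵀ * (hᵀ * X))).det := by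
      rw [hS, show h * hᵀ * X * S₂⁻¹ * Xᵀ = (h * (hᵀ * X)) * (S₂⁻¹ * Xᵀ) by
        simp only [Matrix.mul_assoc], Matrix.det_one_add_mul_comm]
      simp only [Matrix.transpose_mul, Matrix.transpose_transpose, Matrix.mul_assoc]
    rw [h1, ← Matrix.det_mul, Matrix.mul_add, Matrix.mul_one,
      Matrix.mul_nonsing_inv_cancel_left _ _ hp₂.ne'.isUnit]
  have hm : Measurable fun Z : Matrix (Fin n) (Fin n) ℝ =>
      ENNReal.ofReal ((S₂ + Zᵀ * Z).det ^ (-a)) := by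
    have : Continuous fun Z : Matrix (Fin n) (Fin n) ℝ => (S₂ + Zᵀ * Z).det := by fun_prop
    exact (this.measurable.pow_const _).ennreal_ofReal
  have key : ∫⁻ Z : Matrix (Fin n) (Fin n) ℝ, ENNReal.ofReal ((S₂ + Zᵀ * Z).det ^ (-a)) =
      ENNReal.ofReal (S₂.det ^ (-(a - n / 2)) *
        ∏ i ∈ Finset.range n, studentConst n (a - i / 2)) :=
    lintegral_det_add_transpose_mul_self_rpow hS₂ n a ha
  rw [lintegral_mul_left hht hm] at key
  have hsplit : ∀ X : Matrix (Fin n) (Fin n) ℝ,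
      ENNReal.ofReal ((S₂ + (hᵀ * X)ᵀ * (hᵀ * X)).det ^ (-a)) = ENNReal.ofReal (S₂.det ^ (-a)) *
        ENNReal.ofReal ((1 + S₁⁻¹ * X * S₂⁻¹ * Xᵀ).det ^ (-a)) := by
    intro X
    rw [hdet, Real.mul_rpow hp₂.le (det_one_add_pos hS₁ hS₂ X).le,
      ENNReal.ofReal_mul (by positivity)]
  have habs : |hᵀ.det| ^ n = S₁.det ^ (-((n : ℝ) / 2)) := by
    have h0 : |h.det| ^ 2 = S₁.det⁻¹ := by
      have := congrArg Matrix.det hS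
      rw [Matrix.det_mul, Matrix.det_transpose, Matrix.det_nonsing_inv,
        Ring.inverse_eq_inv'] at this
      rw [sq_abs, this, sq]
    have h1 : |h.det| = (S₁.det⁻¹) ^ (1 / 2 : ℝ) := by
      rw [← h0, ← Real.sqrt_eq_rpow, Real.sqrt_sq (abs_nonneg _)]
    rw [Matrix.det_transpose, h1, ← Real.rpow_natCast, ← Real.rpow_mul (by positivity),
      Real.inv_rpow hp₁.le, ← Real.rpow_neg hp₁.le]
    congr 1
    ring
  simp only [hsplit] at key
  rw [lintegral_const_mul' _ _ ENNReal.ofReal_ne_top, habs, prod_studentConst, ← mul_assoc,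
    ← ENNReal.ofReal_mul (by positivity)] at key
  have hc : 0 < S₁.det ^ (-((n : ℝ) / 2)) * S₂.det ^ (-a) := by positivity
  have hc' : ENNReal.ofReal (S₁.det ^ (-((n : ℝ) / 2)) * S₂.det ^ (-a)) ≠ 0 := by
    simpa using hc
  refine (ENNReal.mul_right_inj hc' ENNReal.ofReal_ne_top).1 (key.trans ?_)
  rw [← ENNReal.ofReal_mul hc.le]
  congr 1
  rw [show -(a - (n : ℝ) / 2) = -a + n / 2 by ring, Real.rpow_add hp₂, Real.rpow_neg hp₁.le]
  field_simp

/-! ### The mixture and its density. -/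

/-- Conjugacy: cyclicity of the trace merges both exponents into one trace against $w^{-1}$, so in
$w$ the product is again an inverted gamma kernel, of shape $\delta+n/2$. -/
theorem invMatrixGammaPDF_mul_matrixNormalPDF {n : ℕ} (δ : ℝ)
    (B S₁ S₂ y : Matrix (Fin n) (Fin n) ℝ) {w : Matrix (Fin n) (Fin n) ℝ} (hw : w.PosDef) :
    invMatrixGammaPDF δ 2 S₁ w * matrixNormalPDF B w S₂ y =
      S₁.det ^ δ / (2 ^ ((n : ℝ) * δ) * multiGamma n δ) *
        (S₂.det ^ (-(n : ℝ) / 2) / (2 * Real.pi) ^ ((n : ℝ) ^ 2 / 2)) *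
      (w.det ^ (-(δ + n / 2) - ((n : ℝ) + 1) / 2) *
        Real.exp (-(1 / 2) * ((S₁ + (y - B) * S₂⁻¹ * (y - B)ᵀ) * w⁻¹).trace)) := by
  have htr : ((S₁ + (y - B) * S₂⁻¹ * (y - B)ᵀ) * w⁻¹).trace =
      (S₁ * w⁻¹).trace + (S₂⁻¹ * (y - B)ᵀ * w⁻¹ * (y - B)).trace := by
    rw [Matrix.add_mul, Matrix.trace_add]
    congr 1
    rw [Matrix.trace_mul_comm (S₂⁻¹ * (y - B)ᵀ * w⁻¹)]
    simp only [Matrix.mul_assoc]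
  rw [htr, mul_add, Real.exp_add, show -(δ + (n : ℝ) / 2) - ((n : ℝ) + 1) / 2 =
    (-δ - ((n : ℝ) + 1) / 2) + (-(n : ℝ) / 2) by ring, Real.rpow_add hw.det_pos,
    invMatrixGammaPDF, matrixNormalPDF]
  ring

theorem measurable_invMatrixGammaPDF {n : ℕ} (δ β : ℝ) (Ψ : Matrix (Fin n) (Fin n) ℝ) :
    Measurable fun W => ENNReal.ofReal (invMatrixGammaPDF δ β Ψ W) := by
  have h1 : Continuous fun W : Matrix (Fin n) (Fin n) ℝ => W.det := by fun_prop
  have h2 : Continuous fun W : Matrix (Fin n) (Fin n) ℝ => -(1 / β) * (Ψ * W).trace := by fun_prop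
  exact (((h1.measurable.pow_const _).const_mul _).mul
    (h2.measurable.comp measurable_matrix_inv).exp).ennreal_ofReal

theorem measurable_matrixNormalPDF {n : ℕ} (M Ω₂ : Matrix (Fin n) (Fin n) ℝ) :
    Measurable fun p : Matrix (Fin n) (Fin n) ℝ × Matrix (Fin n) (Fin n) ℝ =>
      ENNReal.ofReal (matrixNormalPDF M p.1 Ω₂ p.2) := by
  have h1 : Continuous fun p : Matrix (Fin n) (Fin n) ℝ × Matrix (Fin n) (Fin n) ℝ => p.1.det := by
    fun_prop
  have h2 : Continuous fun p : Matrix (Fin n) (Fin n) ℝ × Matrix (Fin n) (Fin n) ℝ =>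
    -(1 / 2) * (Ω₂⁻¹ * (p.2 - M)ᵀ * p.1 * (p.2 - M)).trace := by fun_prop
  exact ((((h1.measurable.pow_const _).mul_const _).div_const _).mul
    (h2.measurable.comp ((measurable_matrix_inv.comp measurable_fst).prodMk
      measurable_snd)).exp).ennreal_ofReal

/-- The mixture of matrix normal distributions over an inverted matrix gamma distributed row
covariance has a density proportional to a power of a determinant. -/
theorem lintegral_matrixNormal_invMatrixGamma {n : ℕ} {δ : ℝ} (hδ : 0 < multiGamma n δ)
    (B : Matrix (Fin n) (Fin n) ℝ) {S₁ S₂ : Matrix (Fin n) (Fin n) ℝ} (hS₁ : S₁.PosDef)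
    (hS₂ : S₂.PosDef) :
    ∃ K : ENNReal, ∀ s, MeasurableSet s →
      ∫⁻ w, matrixNormal B w S₂ s ∂invMatrixGamma δ 2 S₁ =
        ∫⁻ y in s, K *
          ENNReal.ofReal ((1 + S₁⁻¹ * (y - B) * S₂⁻¹ * (y - B)ᵀ).det ^ (-(δ + n / 2))) := by
  have hp₁ := hS₁.det_pos
  have hp₂ := hS₂.det_pos
  set c : ℝ := S₁.det ^ δ / (2 ^ ((n : ℝ) * δ) * multiGamma n δ) *
        (S₂.det ^ (-(n : ℝ) / 2) / (2 * Real.pi) ^ ((n : ℝ) ^ 2 / 2)) with hc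
  have hc0 : 0 ≤ c := by positivity
  -- The factors are the two normalizing constants, the power of $|\Sigma_1|$ split off from
  -- $|\Psi_y|^{-(\delta+n/2)}$, and the unevaluated integral at the identity.
  refine ⟨ENNReal.ofReal c * (ENNReal.ofReal (S₁.det ^ (-(δ + n / 2))) *
    invGammaIntegral (δ + n / 2) (1 : Matrix (Fin n) (Fin n) ℝ)), fun s hs => ?_⟩
  have hm := measurable_matrixNormalPDF B S₂
  have hN : ∀ w : Matrix (Fin n) (Fin n) ℝ, matrixNormal B w S₂ s =
      ∫⁻ y in s, ENNReal.ofReal (matrixNormalPDF B w S₂ y) := fun w => withDensity_apply _ hs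
  have hNm : Measurable fun w : Matrix (Fin n) (Fin n) ℝ =>
      ∫⁻ y in s, ENNReal.ofReal (matrixNormalPDF B w S₂ y) :=
    hm.lintegral_prod_right'
  simp only [hN]
  rw [invMatrixGamma, lintegral_withDensity_eq_lintegral_mul _
    (measurable_invMatrixGammaPDF δ 2 S₁) hNm]
  simp only [Pi.mul_apply]
  simp only [← lintegral_const_mul' _ _ ENNReal.ofReal_ne_top]
  rw [lintegral_lintegral_swap]
  swap
  · exact (((measurable_invMatrixGammaPDF δ 2 S₁).comp measurable_fst).mul hm).aemeasurable
  refine lintegral_congr fun y => ?_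
  have hΨ := posDef_add_mul_inv_mul_transpose hS₁ hS₂ (y - B)
  have hstep : ∫⁻ w in {W : Matrix (Fin n) (Fin n) ℝ | W.PosDef},
      ENNReal.ofReal (invMatrixGammaPDF δ 2 S₁ w) *
        ENNReal.ofReal (matrixNormalPDF B w S₂ y) ∂symVolume n =
      ENNReal.ofReal c *
        invGammaIntegral (δ + n / 2) (S₁ + (y - B) * S₂⁻¹ * (y - B)ᵀ) := by
    rw [invGammaIntegral, ← lintegral_const_mul' _ _ ENNReal.ofReal_ne_top]
    refine setLIntegral_congr_fun measurableSet_posDef fun w hw => ?_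
    have hw' : w.PosDef := hw
    have hpw := hw'.det_pos
    have h0 : 0 ≤ invMatrixGammaPDF δ 2 S₁ w := by
      rw [invMatrixGammaPDF]
      positivity
    rw [← ENNReal.ofReal_mul h0, ← ENNReal.ofReal_mul hc0,
      invMatrixGammaPDF_mul_matrixNormalPDF δ B S₁ S₂ y hw']
  rw [hstep, invGammaIntegral_eq _ hΨ, det_add_mul_inv_mul_transpose hS₁,
    Real.mul_rpow hp₁.le (det_one_add_pos hS₁ hS₂ _).le,
    ENNReal.ofReal_mul (p := S₁.det ^ (-(δ + (n : ℝ) / 2))) (by positivity)]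
  ring

/-- Shows the constant of the $t$ density to be the reciprocal of the integral found in
`lintegral_det_one_add_rpow`. -/
theorem matrixTPDF_eq {n : ℕ} (ν : ℝ) (B : Matrix (Fin n) (Fin n) ℝ)
    {S₁ S₂ : Matrix (Fin n) (Fin n) ℝ} (hS₁ : S₁.PosDef) (hS₂ : S₂.PosDef)
    (y : Matrix (Fin n) (Fin n) ℝ) :
    matrixTPDF ν B S₁ S₂ y =
      (S₁.det ^ ((n : ℝ) / 2) * S₂.det ^ ((n : ℝ) / 2) *
        (Real.pi ^ ((n : ℝ) ^ 2 / 2) * multiGamma n ((ν + n - 1) / 2) /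
          multiGamma n ((ν + 2 * n - 1) / 2)))⁻¹ *
      (1 + S₁⁻¹ * (y - B) * S₂⁻¹ * (y - B)ᵀ).det ^ (-((ν + 2 * (n : ℝ) - 1) / 2)) := by
  rw [matrixTPDF, neg_div, neg_div, Real.rpow_neg hS₁.det_pos.le, Real.rpow_neg hS₂.det_pos.le,
    mul_inv, mul_inv, inv_div]
  ring

end MatrixT

theorem theorem1 {Ω : Type*} [MeasurableSpace Ω] (P : Measure Ω) [IsProbabilityMeasure P]
    (n : ℕ) (ν : ℝ) (hν : 0 < ν)
    (B S₁ S₂ : Matrix (Fin n) (Fin n) ℝ) (hS₁ : S₁.PosDef) (hS₂ : S₂.PosDef)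
    (W Y : Ω → Matrix (Fin n) (Fin n) ℝ)
    (hW : HasLaw W (MatrixT.invMatrixGamma ((ν + (n : ℝ) - 1) / 2) 2 S₁) P)
    (hY : AEMeasurable Y P)
    (hYW : ∀ᵐ w ∂(P.map W), condDistrib Y W P w = MatrixT.matrixNormal B w S₂) :
    HasLaw Y (MatrixT.matrixT ν B S₁ S₂) P := by
  -- At the extreme index $i=n-1$, both positivity of the arguments of $\Gamma_n((\nu+n-1)/2)$ and
  -- convergence of the row integrals amount to $\nu>0$.
  have hlt : ∀ i < n, (i : ℝ) + 1 ≤ n := fun i hi => by exact_mod_cast hi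
  have hδ : 0 < MatrixT.multiGamma n ((ν + (n : ℝ) - 1) / 2) :=
    MatrixT.multiGamma_pos fun i hi => by linarith [hlt i hi]
  have ha : 0 < MatrixT.multiGamma n ((ν + 2 * (n : ℝ) - 1) / 2) :=
    MatrixT.multiGamma_pos fun i hi => by linarith [hlt i hi, (Nat.cast_nonneg n : (0 : ℝ) ≤ n)]
  have hp₁ := hS₁.det_pos
  have hp₂ := hS₂.det_pos
  obtain ⟨K, hK⟩ := MatrixT.lintegral_matrixNormal_invMatrixGamma hδ B hS₁ hS₂
  have hT := MatrixT.lintegral_det_one_add_rpow (a := (ν + 2 * (n : ℝ) - 1) / 2)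
    (fun i hi => by linarith [hlt i hi]) hS₁ hS₂ B
  rw [show (ν + (n : ℝ) - 1) / 2 + n / 2 = (ν + 2 * (n : ℝ) - 1) / 2 by ring] at hK
  rw [show (ν + 2 * (n : ℝ) - 1) / 2 - n / 2 = (ν + (n : ℝ) - 1) / 2 by ring] at hT
  set J : ℝ := S₁.det ^ ((n : ℝ) / 2) * S₂.det ^ ((n : ℝ) / 2) *
        (Real.pi ^ ((n : ℝ) ^ 2 / 2) * MatrixT.multiGamma n ((ν + n - 1) / 2) /
          MatrixT.multiGamma n ((ν + 2 * n - 1) / 2)) with hJ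
  have hJ0 : 0 < J := by positivity
  have hm : Measurable fun y : Matrix (Fin n) (Fin n) ℝ => ENNReal.ofReal
      ((1 + S₁⁻¹ * (y - B) * S₂⁻¹ * (y - B)ᵀ).det ^ (-((ν + 2 * (n : ℝ) - 1) / 2))) := by
    have : Continuous fun y : Matrix (Fin n) (Fin n) ℝ =>
      (1 + S₁⁻¹ * (y - B) * S₂⁻¹ * (y - B)ᵀ).det := by fun_prop
    exact (this.measurable.pow_const _).ennreal_ofReal
  have hlaw : ∀ s, MeasurableSet s → P.map Y s = ∫⁻ w, MatrixT.matrixNormal B w S₂ s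
      ∂MatrixT.invMatrixGamma ((ν + (n : ℝ) - 1) / 2) 2 S₁ := by
    intro s hs
    rw [← condDistrib_comp_map hW.aemeasurable hY, Measure.bind_apply hs (Kernel.aemeasurable _),
      ← hW.map_eq]
    refine lintegral_congr_ae ?_
    filter_upwards [hYW] with w hw
    rw [hw]
  -- Taking the whole space in `hlaw` gives $1=K\cdot J$, which determines $K$ and shows that it is
  -- finite.
  have hKJ : K = ENNReal.ofReal J⁻¹ := by
    have : IsProbabilityMeasure (P.map Y) := Measure.isProbabilityMeasure_map hY
    have h1 := hlaw Set.univ MeasurableSet.univ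
    rw [hK _ MeasurableSet.univ, measure_univ, Measure.restrict_univ, lintegral_const_mul _ hm,
      hT] at h1
    rw [ENNReal.ofReal_inv_of_pos hJ0]
    exact ENNReal.eq_inv_of_mul_eq_one_left h1.symm
  refine ⟨hY, Measure.ext fun s hs => ?_⟩
  rw [hlaw s hs, hK s hs, MatrixT.matrixT, withDensity_apply _ hs]
  refine lintegral_congr fun y => ?_
  rw [hKJ, ← ENNReal.ofReal_mul (by positivity), MatrixT.matrixTPDF_eq ν B hS₁ hS₂]
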